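/- Let $n,m\ge 0$ be integers, let $A\subset\mathbb R^{n+m}$ be Lebesgue measurable and let $f:A\to\mathbb R^n$ be Lipschitz (Euclidean norms). Let $\omega_n$ be the volume of the unit ball of $\mathbb R^n$. For $E\subset\mathbb R^n$ let $$\mathcal H^n_\infty(E)=\inf\Big\{\frac{\omega_n}{2^n}\sum_{i=1}^\infty(\operatorname{diam}A_i)^n:\ E\subset\bigcup_{i=1}^\infty A_i\Big\}$$ denote the Hausdorff content, where the $A_i\subset\mathbb R^n$ are arbitrary sets (empty sets contribute $0$, and $(\operatorname{diam} A_i)^0=1$ for nonempty $A_i$), and for $x\in A$ put $$\Theta_*^n(f,x)=\liminf_{r\to0^+}\frac{\mathcal H^n_\infty(f(B(x,r)\cap A))}{\omega_nr^n},\qquad \Theta^{*n}(f,x)=\limsup_{r\to0^+}\frac{\mathcal H^n_\infty(f(B(x,r)\cap A))}{\omega_nr^n}.$$ A linear map $L:\mathbb R^{n+m}\to\mathbb R^n$ is an approximate derivative of $f$ at $x\in A$ if there is a measurable set $S\subset A$ such that $x\in S$ is a Lebesgue density point of $S$ and $|f(y)-f(x)-L(y-x)|/|y-x|\to0$ as $y\to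 x$, $y\in S\setminus\{x\}$; one then writes $Df(x)=L$ and $|J^nf|(x)=\sqrt{\det\big(Df(x)\,Df(x)^T\big)}$. Then for almost every $x\in A$ the map $f$ has an approximate derivative at $x$, and for every approximate derivative $Df(x)$ of $f$ at $x$ $$\Theta_*^n(f,x)=\Theta^{*n}(f,x)=|J^nf|(x).$$ -/

import Mathlib

open MeasureTheory Filter Topology
open scoped ENNReal

/-- `ω_n`: the Lebesgue measure of the unit ball of `ℝⁿ`. -/
noncomputable def unitBallVolume (n : ℕ) : ℝ≥0∞ :=
  volume (Metric.ball (0 : EuclideanSpace ℝ (Fin n)) 1)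

/-- The Hausdorff content `𝓗ⁿ_∞(E)`: the infimum of `(ω_n / 2ⁿ) ∑ᵢ (diam Tᵢ)ⁿ` over all countable
coverings `(Tᵢ)` of `E` by arbitrary sets. The supremum over `(T i).Nonempty` only says that empty
sets contribute `0`; it matters for `n = 0` alone, where `0 ^ 0 = 1`. -/
noncomputable def hausdorffContent {X : Type*} [MetricSpace X] (n : ℕ) (E : Set X) : ℝ≥0∞ :=
  ⨅ (T : ℕ → Set X) (_ : E ⊆ ⋃ i, T i),
    unitBallVolume n / 2 ^ n * ∑' i, ⨆ _ : (T i).Nonempty, Metric.ediam (T i) ^ n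

/-- The quotient `𝓗ⁿ_∞(f(B(x,r) ∩ A)) / (ω_n rⁿ)`. -/
noncomputable def contentRatio {k : ℕ} {X : Type*} [MetricSpace X] (n : ℕ)
    (f : EuclideanSpace ℝ (Fin k) → X) (A : Set (EuclideanSpace ℝ (Fin k)))
    (x : EuclideanSpace ℝ (Fin k)) (r : ℝ) : ℝ≥0∞ :=
  hausdorffContent n (f '' (Metric.ball x r ∩ A)) / (unitBallVolume n * ENNReal.ofReal r ^ n)

/-- The upper `n`-density `Θ^{*n}(f, x)` of `f : A → X`. Only the values of `f` on `A` matter. -/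
noncomputable def upperDensity {k : ℕ} {X : Type*} [MetricSpace X] (n : ℕ)
    (f : EuclideanSpace ℝ (Fin k) → X) (A : Set (EuclideanSpace ℝ (Fin k)))
    (x : EuclideanSpace ℝ (Fin k)) : ℝ≥0∞ :=
  limsup (contentRatio n f A x) (𝓝[>] 0)

/-- The lower `n`-density `Θ_*^n(f, x)` of `f : A → X`. Only the values of `f` on `A` matter. -/
noncomputable def lowerDensity {k : ℕ} {X : Type*} [MetricSpace X] (n : ℕ)
    (f : EuclideanSpace ℝ (Fin k) → X) (A : Set (EuclideanSpace ℝ (Fin k)))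
    (x : EuclideanSpace ℝ (Fin k)) : ℝ≥0∞ :=
  liminf (contentRatio n f A x) (𝓝[>] 0)

/-- `x ∈ E` is a (Lebesgue) density point of `E`. -/
def IsDensityPoint {k : ℕ} (E : Set (EuclideanSpace ℝ (Fin k)))
    (x : EuclideanSpace ℝ (Fin k)) : Prop :=
  x ∈ E ∧ Tendsto (fun d : ℝ => volume (E ∩ Metric.ball x d) / volume (Metric.ball x d))
    (𝓝[>] 0) (𝓝 1)

/-- `L` is an approximate derivative at `x` of the map `f : A → ℝⁿ`: there is a (Lebesgue)
measurable set `S ⊆ A` having `x` as a density point such that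
`|f y - f x - L (y - x)| / |y - x| → 0` as `y → x` within `S`. -/
def HasApproxDerivAt {k n : ℕ} (f : EuclideanSpace ℝ (Fin k) → EuclideanSpace ℝ (Fin n))
    (A : Set (EuclideanSpace ℝ (Fin k)))
    (L : EuclideanSpace ℝ (Fin k) →L[ℝ] EuclideanSpace ℝ (Fin n))
    (x : EuclideanSpace ℝ (Fin k)) : Prop :=
  ∃ S ⊆ A, NullMeasurableSet S volume ∧ IsDensityPoint S x ∧ HasFDerivWithinAt f L S x

/-- The `n × k` matrix of a linear map `ℝᵏ → ℝⁿ` in the standard bases. -/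
noncomputable def stdMatrix {k n : ℕ}
    (L : EuclideanSpace ℝ (Fin k) →L[ℝ] EuclideanSpace ℝ (Fin n)) : Matrix (Fin n) (Fin k) ℝ :=
  LinearMap.toMatrix (EuclideanSpace.basisFun (Fin k) ℝ).toBasis
    (EuclideanSpace.basisFun (Fin n) ℝ).toBasis L.toLinearMap

/-- The Jacobian `√ det (D Dᵀ)` of a linear map `ℝᵏ → ℝⁿ` with matrix `D`. -/
noncomputable def jacobian {k n : ℕ}
    (L : EuclideanSpace ℝ (Fin k) →L[ℝ] EuclideanSpace ℝ (Fin n)) : ℝ :=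
  Real.sqrt (stdMatrix L * (stdMatrix L).transpose).det

/-! In `ℝⁿ` the content `𝓗ⁿ_∞` is Lebesgue outer measure: the isodiametric inequality gives
`volume_le_hausdorffContent`, Besicovitch coverings by balls give the converse. The densities thus
measure the volume of `f(B(x,r) ∩ A)` against `ω_n rⁿ`.

Since `f` is Lipschitz, an approximate derivative `L` is a derivative within `A`. Rescaled by `1/r`,
the image lies in a small neighbourhood of the ellipsoid `L(B(0,1))`, of volume `ω_n J(L)`; this is
`upperDensity_le_jacobian`.

For the lower bound, differentiability at `x` alone does not prevent the image from having holes.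
Almost every `x`, however, is a density point of sets `t ⊆ A` on which `f` is uniformly close to
linear (`ae_exists_approximatesLinearOn`). If `J(L) ≠ 0`, adjoining the coordinates along `ker L`
turns `f` into a map between spaces of equal dimension, close on `t` to a linear map of determinant
`± J(L)`. Such a map nearly multiplies volumes by `J(L)`, and Fubini removes the extra coordinates
(`eventually_le_contentRatio`). -/

/-! ### Steiner symmetrization and the isodiametric inequality -/

/-- Two sets of reals of length greater than `2 |a|` and `2 |b|` contain points at distance at
least `|a - b|`. -/
lemma exists_abs_sub_le_abs_sub {P Q : Set ℝ} {a b : ℝ}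
    (hP : ENNReal.ofReal (2 * |a|) < volume P) (hQ : ENNReal.ofReal (2 * |b|) < volume Q) :
    ∃ s ∈ P, ∃ t ∈ Q, |a - b| ≤ |s - t| := by
  -- Otherwise `sup P - inf Q` and `sup Q - inf P` are at most `|a - b|`; adding them bounds the sum
  -- of the two lengths by `2 |a - b| ≤ 2 |a| + 2 |b|`.
  by_contra! H
  have hPn : P.Nonempty := nonempty_of_measure_ne_zero (bot_lt_of_lt hP).ne'
  have hQn : Q.Nonempty := nonempty_of_measure_ne_zero (bot_lt_of_lt hQ).ne'
  obtain ⟨s₀, hs₀⟩ := hPn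
  obtain ⟨t₀, ht₀⟩ := hQn
  have hb : ∀ s ∈ P, ∀ t ∈ Q, s - t ≤ |a - b| ∧ t - s ≤ |a - b| := fun s hs t ht ↦ by
    have := abs_lt.1 (H s hs t ht); constructor <;> linarith
  have hPa : BddAbove P := ⟨t₀ + |a - b|, fun s hs ↦ by linarith [(hb s hs t₀ ht₀).1]⟩
  have hPb : BddBelow P := ⟨t₀ - |a - b|, fun s hs ↦ by linarith [(hb s hs t₀ ht₀).2]⟩
  have hQa : BddAbove Q := ⟨s₀ + |a - b|, fun t ht ↦ by linarith [(hb s₀ hs₀ t ht).2]⟩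
  have hQb : BddBelow Q := ⟨s₀ - |a - b|, fun t ht ↦ by linarith [(hb s₀ hs₀ t ht).1]⟩
  have key : ∀ {R : Set ℝ} {c : ℝ}, BddAbove R → BddBelow R →
      ENNReal.ofReal (2 * |c|) < volume R → 2 * |c| < sSup R - sInf R := by
    intro R c h1 h2 h
    have h3 : volume R ≤ ENNReal.ofReal (sSup R - sInf R) := by
      rw [← Real.volume_Icc]
      exact measure_mono fun r hr ↦ ⟨csInf_le h2 hr, le_csSup h1 hr⟩
    exact (ENNReal.ofReal_lt_ofReal_iff_of_nonneg (by positivity)).1 (h.trans_le h3)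
  have h1 : sSup P ≤ sInf Q + |a - b| := csSup_le ⟨s₀, hs₀⟩ fun s hs ↦ by
    have : s - |a - b| ≤ sInf Q := le_csInf ⟨t₀, ht₀⟩ fun t ht ↦ by linarith [(hb s hs t ht).1]
    linarith
  have h2 : sSup Q ≤ sInf P + |a - b| := csSup_le ⟨t₀, ht₀⟩ fun t ht ↦ by
    have : t - |a - b| ≤ sInf P := le_csInf ⟨s₀, hs₀⟩ fun s hs ↦ by linarith [(hb s hs t ht).2]
    linarith
  linarith [key hPa hPb hP, key hQa hQb hQ, abs_sub a b]

section Isodiametric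

variable {ι : Type*} [DecidableEq ι]

/-- The Steiner symmetrization of `T` with respect to the hyperplane `x i = 0`. -/
def steinerSymm (i : ι) (T : Set (ι → ℝ)) : Set (ι → ℝ) :=
  {x | ENNReal.ofReal (2 * |x i|) < volume {t : ℝ | Function.update x i t ∈ T}}

lemma volume_setOf_two_mul_abs_lt (V : ℝ≥0∞) :
    volume {t : ℝ | ENNReal.ofReal (2 * |t|) < V} = V := by
  induction V with
  | top => simp [ENNReal.mul_lt_top_iff]
  | coe v =>
    have h : {t : ℝ | ENNReal.ofReal (2 * |t|) < v} = Set.Ioo (-(v / 2 : ℝ)) (v / 2) := by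
      ext t
      rw [Set.mem_ofPred_eq, ← ENNReal.ofReal_coe_nnreal,
        ENNReal.ofReal_lt_ofReal_iff_of_nonneg (by positivity), Set.mem_Ioo, ← abs_lt]
      constructor <;> intro h <;> linarith
    rw [h, Real.volume_Ioo]
    simp

lemma lintegral_indicator_update (i : ι) {T : Set (ι → ℝ)} (hT : MeasurableSet T) (x : ι → ℝ) :
    ∫⁻ t : ℝ, T.indicator 1 (Function.update x i t) =
      volume {t : ℝ | Function.update x i t ∈ T} := by
  have hm : MeasurableSet {t : ℝ | Function.update x i t ∈ T} := measurable_update x hT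
  rw [← lintegral_indicator_one hm]
  rfl

lemma measurableSet_steinerSymm (i : ι) {T : Set (ι → ℝ)} (hT : MeasurableSet T) :
    MeasurableSet (steinerSymm i T) := by
  refine measurableSet_lt (by fun_prop) ?_
  have h := (measurable_one.indicator hT : Measurable (T.indicator (1 : (ι → ℝ) → ℝ≥0∞))).lmarginal
    (fun _ : ι ↦ (volume : Measure ℝ)) (s := {i})
  rw [lmarginal_singleton] at h
  simpa only [lintegral_indicator_update i hT] using h

lemma steinerSymm_reflect_self (i : ι) {T : Set (ι → ℝ)} :
    ∀ x ∈ steinerSymm i T, Function.update x i (-(x i)) ∈ steinerSymm i T := by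
  intro x hx
  simpa [steinerSymm] using hx

/-- Reflecting in `x j` carries the section of `T` along axis `i` through `x` into the one through
the reflected point. Hence symmetries already obtained survive later symmetrizations. -/
lemma steinerSymm_reflect_of_ne {i j : ι} (hij : j ≠ i) {T : Set (ι → ℝ)}
    (h : ∀ x ∈ T, Function.update x j (-(x j)) ∈ T) :
    ∀ x ∈ steinerSymm i T, Function.update x j (-(x j)) ∈ steinerSymm i T := by
  intro x hx
  simp only [steinerSymm, Set.mem_ofPred_eq, Function.update_of_ne hij.symm] at hx ⊢
  refine hx.trans_le (measure_mono fun t ht ↦ ?_)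
  have := h _ ht
  rwa [Function.update_of_ne hij, Function.update_comm hij.symm] at this

variable [Fintype ι]

/-- Fubini: each section along axis `i` is replaced by a centred interval of the same length. -/
lemma volume_steinerSymm (i : ι) {T : Set (ι → ℝ)} (hT : MeasurableSet T) :
    volume (steinerSymm i T) = volume T := by
  have hS := measurableSet_steinerSymm i hT
  rw [← lintegral_indicator_one hT, ← lintegral_indicator_one hS, volume_pi]
  refine lintegral_eq_of_lmarginal_eq {i} (measurable_one.indicator hS)
    (measurable_one.indicator hT) ?_
  simp only [lmarginal_singleton]
  ext x
  rw [lintegral_indicator_update i hT, lintegral_indicator_update i hS]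
  simp only [steinerSymm, Set.mem_ofPred_eq, Function.update_self, Function.update_idem]
  exact volume_setOf_two_mul_abs_lt _

/-- The sections of `T` through `x` and `y` contain points whose `i`-th coordinates are at least `|x
i - y i|` apart; the other coordinates are unchanged. -/
lemma sum_sq_sub_le_of_mem_steinerSymm (i : ι) {T : Set (ι → ℝ)} {d : ℝ}
    (hd : ∀ x ∈ T, ∀ y ∈ T, ∑ j, (x j - y j) ^ 2 ≤ d) :
    ∀ x ∈ steinerSymm i T, ∀ y ∈ steinerSymm i T, ∑ j, (x j - y j) ^ 2 ≤ d := by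
  intro x hx y hy
  obtain ⟨s, hs, t, ht, hst⟩ := exists_abs_sub_le_abs_sub hx hy
  refine le_trans (Finset.sum_le_sum fun j _ ↦ ?_) (hd _ hs _ ht)
  rcases eq_or_ne j i with rfl | hj
  · simpa using sq_le_sq.2 hst
  · simp [hj]

lemma exists_symmetrization (s : Finset ι) {T : Set (ι → ℝ)} (hT : MeasurableSet T) {d : ℝ}
    (hd : ∀ x ∈ T, ∀ y ∈ T, ∑ j, (x j - y j) ^ 2 ≤ d) :
    ∃ T' : Set (ι → ℝ), MeasurableSet T' ∧ volume T' = volume T ∧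
      (∀ x ∈ T', ∀ y ∈ T', ∑ j, (x j - y j) ^ 2 ≤ d) ∧
      ∀ j ∈ s, ∀ x ∈ T', Function.update x j (-(x j)) ∈ T' := by
  induction s using Finset.induction with
  | empty => exact ⟨T, hT, rfl, hd, by simp⟩
  | insert i s hi ih =>
    obtain ⟨T', h1, h2, h3, h4⟩ := ih
    refine ⟨steinerSymm i T', measurableSet_steinerSymm i h1, (volume_steinerSymm i h1).trans h2,
      sum_sq_sub_le_of_mem_steinerSymm i h3, fun j hj ↦ ?_⟩
    rcases eq_or_ne j i with rfl | hji
    · exact steinerSymm_reflect_self j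
    · exact steinerSymm_reflect_of_ne hji (h4 j (Finset.mem_of_mem_insert_of_ne hj hji))

lemma neg_mem_of_reflect_mem {T : Set (ι → ℝ)}
    (h : ∀ j, ∀ x ∈ T, Function.update x j (-(x j)) ∈ T) {x : ι → ℝ} (hx : x ∈ T) : -x ∈ T := by
  have key : ∀ s : Finset ι, (fun j ↦ if j ∈ s then -(x j) else x j) ∈ T := by
    intro s
    induction s using Finset.induction with
    | empty => simpa using hx
    | insert i s hi ih =>
      convert h i _ ih using 1
      ext j
      rcases eq_or_ne j i with rfl | hj
      · simp [hi]
      · simp [hj]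
  have h := key Finset.univ
  simp only [Finset.mem_univ, if_true] at h
  exact h

/-- Symmetrizing in every coordinate gives a set containing `-x` with each `x`, so `2 |x| ≤ d` there
and the set lies in the ball of radius `d / 2`. -/
lemma volume_le_volume_sum_sq_le {T : Set (ι → ℝ)} (hT : MeasurableSet T) {d : ℝ}
    (hd : ∀ x ∈ T, ∀ y ∈ T, ∑ j, (x j - y j) ^ 2 ≤ d ^ 2) :
    volume T ≤ volume {x : ι → ℝ | ∑ j, x j ^ 2 ≤ (d / 2) ^ 2} := by
  obtain ⟨T', h1, h2, h3, h4⟩ := exists_symmetrization Finset.univ hT hd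
  rw [← h2]
  refine measure_mono fun x hx ↦ ?_
  have := h3 _ hx _ (neg_mem_of_reflect_mem (fun j ↦ h4 j (Finset.mem_univ j)) hx)
  have h5 : ∑ j, (x j - (-x) j) ^ 2 = 4 * ∑ j, x j ^ 2 := by
    rw [Finset.mul_sum]; exact Finset.sum_congr rfl fun j _ ↦ by simp; ring
  rw [h5] at this
  simp only [Set.mem_ofPred_eq]
  linarith

end Isodiametric

/-! ### Hausdorff content and Lebesgue measure -/

lemma unitBallVolume_pos (n : ℕ) : 0 < unitBallVolume n :=
  Metric.measure_ball_pos _ _ one_pos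

lemma unitBallVolume_ne_top (n : ℕ) : unitBallVolume n ≠ ∞ := measure_ball_lt_top.ne

lemma volume_closedBall_eq {n : ℕ} (x : EuclideanSpace ℝ (Fin n)) {r : ℝ} (hr : 0 ≤ r) :
    volume (Metric.closedBall x r) = unitBallVolume n * ENNReal.ofReal r ^ n := by
  rw [Measure.addHaar_closedBall _ _ hr, mul_comm, unitBallVolume, ENNReal.ofReal_pow hr]
  simp

lemma volume_ball_eq {n : ℕ} (x : EuclideanSpace ℝ (Fin n)) {r : ℝ} (hr : 0 < r) :
    volume (Metric.ball x r) = unitBallVolume n * ENNReal.ofReal r ^ n := by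
  rw [Measure.addHaar_ball_of_pos _ _ hr, mul_comm, unitBallVolume, ENNReal.ofReal_pow hr.le]
  simp

/-- The isodiametric inequality. -/
lemma volume_le_ediam_pow {n : ℕ} {T : Set (EuclideanSpace ℝ (Fin n))} :
    volume T ≤ unitBallVolume n / 2 ^ n * ⨆ _ : T.Nonempty, Metric.ediam T ^ n := by
  rcases T.eq_empty_or_nonempty with rfl | hne
  · simp
  rw [ciSup_pos hne]
  by_cases htop : Metric.ediam T = ∞
  · have hn : n ≠ 0 := by
      rintro rfl
      rw [Metric.ediam_subsingleton (Set.subsingleton_of_subsingleton)] at htop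
      exact ENNReal.zero_ne_top htop
    rw [htop, ENNReal.top_pow hn, ENNReal.mul_top]
    · exact le_top
    · exact (ENNReal.div_pos (unitBallVolume_pos n).ne' (by simp)).ne'
  set d := (Metric.ediam T).toReal with hdef
  have hd0 : 0 ≤ d := ENNReal.toReal_nonneg
  -- The closure has the same diameter and is measurable, as symmetrization requires.
  have hcl : ∀ x ∈ closure T, ∀ y ∈ closure T, dist x y ≤ d := fun x hx y hy ↦ by
    rw [hdef, ← Metric.ediam_closure, dist_edist]
    exact ENNReal.toReal_mono (by rwa [Metric.ediam_closure])
      (Metric.edist_le_ediam_of_mem hx hy)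
  have hmp := PiLp.volume_preserving_toLp (Fin n)
  have h1 : volume (closure T) ≤ volume (Metric.closedBall (0 : EuclideanSpace ℝ (Fin n)) (d / 2)) := by
    rw [← hmp.measure_preimage isClosed_closure.measurableSet.nullMeasurableSet,
      ← hmp.measure_preimage Metric.isClosed_closedBall.measurableSet.nullMeasurableSet]
    refine (volume_le_volume_sum_sq_le (d := d)
      (hmp.measurable isClosed_closure.measurableSet) fun x hx y hy ↦ ?_).trans
      (measure_mono fun x hx ↦ ?_)
    · have := hcl _ hx _ hy
      rw [EuclideanSpace.dist_eq, Real.sqrt_le_left hd0] at this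
      simpa [Real.dist_eq] using this
    · simp only [Set.mem_preimage, mem_closedBall_zero_iff, EuclideanSpace.norm_eq]
      rw [Real.sqrt_le_left (by positivity)]
      simpa using hx
  refine (measure_mono subset_closure).trans (h1.trans_eq ?_)
  rw [volume_closedBall_eq _ (by positivity), ENNReal.ofReal_div_of_pos two_pos, hdef,
    ENNReal.ofReal_toReal htop, ENNReal.ofReal_ofNat, div_eq_mul_inv, div_eq_mul_inv, mul_pow,
    ENNReal.inv_pow]
  ring

lemma volume_le_hausdorffContent {n : ℕ} (E : Set (EuclideanSpace ℝ (Fin n))) :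
    volume E ≤ hausdorffContent n E := by
  refine le_iInf₂ fun T hT ↦ ?_
  rw [← ENNReal.tsum_mul_left]
  exact (measure_mono hT).trans ((measure_iUnion_le T).trans
    (ENNReal.tsum_le_tsum fun i ↦ volume_le_ediam_pow))

lemma hausdorffContent_le_tsum {X : Type*} [MetricSpace X] {n : ℕ} {E : Set X}
    (T : ℕ → Set X) (hT : E ⊆ ⋃ i, T i) : hausdorffContent n E ≤
      unitBallVolume n / 2 ^ n * ∑' i, ⨆ _ : (T i).Nonempty, Metric.ediam (T i) ^ n :=
  iInf₂_le T hT

/-- Besicovitch covers `E` by closed balls of total volume at most `volume E + ε`, and a ball of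
radius `r` costs at most `ω_n / 2ⁿ * (2 r)ⁿ`, its own volume. -/
lemma hausdorffContent_le_volume {n : ℕ} (E : Set (EuclideanSpace ℝ (Fin n))) :
    hausdorffContent n E ≤ volume E := by
  refine ENNReal.le_of_forall_pos_le_add fun ε hε _ ↦ ?_
  obtain ⟨t, r, htc, -, hr, hcov, hsum⟩ := Besicovitch.exists_closedBall_covering_tsum_measure_le
    (volume : Measure (EuclideanSpace ℝ (Fin n))) (ε := ε) (by simpa using hε.ne')
    (fun _ ↦ Set.Ioi 0) E (fun x _ δ hδ ↦ ⟨δ / 2, by simpa using hδ, by simpa using hδ, by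
      linarith⟩)
  refine le_trans ?_ hsum
  have : Countable t := htc
  obtain ⟨e, he⟩ := exists_injective_nat t
  -- Indices outside the range of `e` give the empty set, which costs nothing even for `n = 0`.
  let T : ℕ → Set (EuclideanSpace ℝ (Fin n)) := fun k ↦ ⋃ (x : t) (_ : e x = k),
    Metric.closedBall (x : EuclideanSpace ℝ (Fin n)) (r x)
  have hTe : ∀ x : t, T (e x) = Metric.closedBall (x : EuclideanSpace ℝ (Fin n)) (r x) := by
    intro x
    ext z
    simp only [T, Set.mem_iUnion]
    constructor
    · rintro ⟨y, hy, hz⟩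
      rwa [he hy] at hz
    · exact fun hz ↦ ⟨x, rfl, hz⟩
  refine (hausdorffContent_le_tsum T fun z hz ↦ ?_).trans ?_
  · obtain ⟨x, hx, hzx⟩ := Set.mem_iUnion₂.1 (hcov hz)
    exact Set.mem_iUnion.2 ⟨e ⟨x, hx⟩, by rw [hTe]; exact hzx⟩
  rw [← ENNReal.tsum_mul_left, ← he.tsum_eq]
  · refine ENNReal.tsum_le_tsum fun x ↦ ?_
    have hrx : 0 < r x := hr x x.2
    rw [hTe, volume_closedBall_eq _ hrx.le]
    calc _ ≤ unitBallVolume n / 2 ^ n * (2 * ENNReal.ofReal (r x)) ^ n := by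
          gcongr
          refine iSup_le fun _ ↦ ?_
          gcongr
          rw [← Metric.closedEBall_ofReal hrx.le]
          exact Metric.ediam_closedEBall_le
      _ = unitBallVolume n * ENNReal.ofReal (r x) ^ n := by
          rw [mul_pow, ← mul_assoc, ENNReal.div_mul_cancel (by simp) (by simp)]
  · intro k hk
    by_contra hne
    refine hk ?_
    have : T k = ∅ := by
      refine Set.eq_empty_of_forall_notMem fun z hz ↦ ?_
      simp only [T, Set.mem_iUnion] at hz
      obtain ⟨x, hx, -⟩ := hz
      exact hne ⟨x, hx⟩
    simp [this]

/-- The Hausdorff content of dimension `n` on `ℝⁿ` is the Lebesgue outer measure. -/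
lemma hausdorffContent_eq_volume {n : ℕ} (E : Set (EuclideanSpace ℝ (Fin n))) :
    hausdorffContent n E = volume E :=
  (hausdorffContent_le_volume E).antisymm (volume_le_hausdorffContent E)

/-! ### The Jacobian and orthogonal splitting along the kernel -/

open ContinuousLinearMap in
lemma stdMatrix_mul_transpose {k n : ℕ}
    (L : EuclideanSpace ℝ (Fin k) →L[ℝ] EuclideanSpace ℝ (Fin n)) :
    stdMatrix L * (stdMatrix L).transpose =
      LinearMap.toMatrix (EuclideanSpace.basisFun (Fin n) ℝ).toBasis
        (EuclideanSpace.basisFun (Fin n) ℝ).toBasis (L ∘L adjoint L).toLinearMap := by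
  have h := LinearMap.toMatrix_adjoint (EuclideanSpace.basisFun (Fin k) ℝ)
    (EuclideanSpace.basisFun (Fin n) ℝ) L.toLinearMap
  rw [Matrix.conjTranspose_eq_transpose_of_trivial] at h
  rw [stdMatrix, ← h, ← LinearMap.toMatrix_comp]
  rfl

open ContinuousLinearMap in
lemma jacobian_eq_sqrt_det {k n : ℕ}
    (L : EuclideanSpace ℝ (Fin k) →L[ℝ] EuclideanSpace ℝ (Fin n)) :
    jacobian L = Real.sqrt (L ∘L adjoint L).det := by
  rw [jacobian, stdMatrix_mul_transpose, LinearMap.det_toMatrix]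

lemma jacobian_eq_abs_det {n : ℕ}
    (M : EuclideanSpace ℝ (Fin n) →L[ℝ] EuclideanSpace ℝ (Fin n)) : jacobian M = |M.det| := by
  rw [jacobian, Matrix.det_mul, Matrix.det_transpose, Real.sqrt_mul_self_eq_abs, stdMatrix,
    LinearMap.det_toMatrix]

lemma surjective_of_jacobian_ne_zero {k n : ℕ}
    {L : EuclideanSpace ℝ (Fin k) →L[ℝ] EuclideanSpace ℝ (Fin n)} (h : jacobian L ≠ 0) :
    Function.Surjective L := by
  have hd : (L ∘L ContinuousLinearMap.adjoint L).det ≠ 0 := by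
    intro h0
    rw [jacobian_eq_sqrt_det, h0, Real.sqrt_zero] at h
    exact h rfl
  intro y
  obtain ⟨x, hx⟩ := (LinearEquiv.ofIsUnitDet (f := (L ∘L ContinuousLinearMap.adjoint L).toLinearMap)
    (v := (EuclideanSpace.basisFun (Fin n) ℝ).toBasis)
    (v' := (EuclideanSpace.basisFun (Fin n) ℝ).toBasis)
    (by rw [LinearMap.det_toMatrix]; exact hd.isUnit)).surjective y
  exact ⟨ContinuousLinearMap.adjoint L x, hx⟩

/-- A surjective linear map `ℝⁿ⁺ᵐ → ℝⁿ` is, up to an isometry, the composition of the projection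
`ℝⁿ × ℝᵐ → ℝⁿ` with an endomorphism of `ℝⁿ`. -/
lemma exists_orthogonal_splitting {n m : ℕ}
    {L : EuclideanSpace ℝ (Fin (n + m)) →L[ℝ] EuclideanSpace ℝ (Fin n)}
    (hL : Function.Surjective L) :
    ∃ (U : (EuclideanSpace ℝ (Fin n) × EuclideanSpace ℝ (Fin m)) ≃L[ℝ]
        EuclideanSpace ℝ (Fin (n + m)))
      (M : EuclideanSpace ℝ (Fin n) →L[ℝ] EuclideanSpace ℝ (Fin n)),
      (∀ p, ‖U p‖ ≤ ‖p.1‖ + ‖p.2‖) ∧ (∀ p, ‖p.1‖ ≤ ‖U p‖) ∧ (∀ p, L (U p) = M p.1) ∧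
      |M.det| = jacobian L := by
  let K : Submodule ℝ (EuclideanSpace ℝ (Fin (n + m))) := LinearMap.ker L.toLinearMap
  have hr : Module.finrank ℝ (LinearMap.range L.toLinearMap) = n := by
    rw [LinearMap.range_eq_top.2 hL, finrank_top, finrank_euclideanSpace_fin]
  have hK : Module.finrank ℝ K = m := by
    have := L.toLinearMap.finrank_range_add_finrank_ker
    rw [hr, finrank_euclideanSpace_fin] at this
    exact Nat.add_left_cancel this
  have hV : Module.finrank ℝ Kᗮ = n := by
    have := K.finrank_add_finrank_orthogonal
    rw [hK, finrank_euclideanSpace_fin] at this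
    omega
  let eK := ((stdOrthonormalBasis ℝ K).reindex (finCongr hK)).repr
  let eV := ((stdOrthonormalBasis ℝ Kᗮ).reindex (finCongr hV)).repr
  let a : EuclideanSpace ℝ (Fin n) →ₗᵢ[ℝ] EuclideanSpace ℝ (Fin (n + m)) :=
    Kᗮ.subtypeₗᵢ.comp eV.symm.toLinearIsometry
  let b : EuclideanSpace ℝ (Fin m) →ₗᵢ[ℝ] EuclideanSpace ℝ (Fin (n + m)) :=
    K.subtypeₗᵢ.comp eK.symm.toLinearIsometry
  have hab : ∀ u v, inner ℝ (a u) (b v) = 0 := fun u v ↦ by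
    rw [real_inner_comm]
    exact (eV.symm u).2 _ (eK.symm v).2
  have hLb : ∀ v, L (b v) = 0 := fun v ↦ (eK.symm v).2
  let U₀ := a.toLinearMap.coprod b.toLinearMap
  have hU₀ : ∀ p, U₀ p = a p.1 + b p.2 := fun p ↦ rfl
  have hnorm : ∀ p, ‖U₀ p‖ * ‖U₀ p‖ = ‖p.1‖ * ‖p.1‖ + ‖p.2‖ * ‖p.2‖ := fun p ↦ by
    rw [hU₀, norm_add_sq_eq_norm_sq_add_norm_sq_of_inner_eq_zero _ _ (hab _ _), a.norm_map,
      b.norm_map]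
  have hinj : Function.Injective U₀ := by
    refine (injective_iff_map_eq_zero U₀).2 fun p hp ↦ ?_
    have := hnorm p
    rw [hp, norm_zero] at this
    have h1 : ‖p.1‖ = 0 := by nlinarith [norm_nonneg p.1, norm_nonneg p.2]
    have h2 : ‖p.2‖ = 0 := by nlinarith [norm_nonneg p.1, norm_nonneg p.2]
    exact Prod.ext (norm_eq_zero.1 h1) (norm_eq_zero.1 h2)
  let U := (U₀.linearEquivOfInjective hinj (by simp)).toContinuousLinearEquiv
  have hU : ∀ p, U p = a p.1 + b p.2 := fun p ↦ rfl
  let M := L ∘L a.toContinuousLinearMap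
  have hLU : ∀ p, L (U p) = M p.1 := fun p ↦ by
    rw [hU, map_add, hLb, add_zero]; rfl
  refine ⟨U, M, fun p ↦ ?_, fun p ↦ ?_, hLU, ?_⟩
  · rw [hU]
    exact (norm_add_le _ _).trans_eq (by rw [a.norm_map, b.norm_map])
  · refine abs_le_of_sq_le_sq' ?_ (norm_nonneg _) |>.2
    have := hnorm p
    change ‖p.1‖ ^ 2 ≤ ‖U₀ p‖ ^ 2
    nlinarith [norm_nonneg p.2]
  · rw [← jacobian_eq_abs_det, jacobian_eq_sqrt_det, jacobian_eq_sqrt_det]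
    congr 2
    -- The adjoint of `L` takes values in `(ker L)ᗮ`, the range of `a`; with `M = L ∘ a` this yields
    -- `L L* = M M*`.
    have key : ∀ u, ContinuousLinearMap.adjoint L u = a (ContinuousLinearMap.adjoint M u) := by
      intro u
      refine ext_inner_right ℝ fun y ↦ ?_
      obtain ⟨p, rfl⟩ := U.surjective y
      rw [ContinuousLinearMap.adjoint_inner_left, hLU, hU, inner_add_right, hab, add_zero,
        a.inner_map_map, ContinuousLinearMap.adjoint_inner_left]
    ext1 u
    exact congrArg L (key u).symm

/-- The image of the unit ball under `L` has volume `ω_n` times the Jacobian of `L`. -/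
lemma volume_image_closedBall {n m : ℕ}
    (L : EuclideanSpace ℝ (Fin (n + m)) →L[ℝ] EuclideanSpace ℝ (Fin n)) :
    volume (L '' Metric.closedBall 0 1) = unitBallVolume n * ENNReal.ofReal (jacobian L) := by
  by_cases hL : Function.Surjective L
  · obtain ⟨U, M, h1, h2, h3, h4⟩ := exists_orthogonal_splitting hL
    have : L '' Metric.closedBall 0 1 = M '' Metric.closedBall 0 1 := by
      ext w
      constructor
      · rintro ⟨y, hy, rfl⟩
        obtain ⟨p, rfl⟩ := U.surjective y
        refine ⟨p.1, ?_, (h3 p).symm⟩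
        rw [mem_closedBall_zero_iff] at hy ⊢
        exact (h2 p).trans hy
      · rintro ⟨u, hu, rfl⟩
        refine ⟨U (u, 0), ?_, h3 _⟩
        rw [mem_closedBall_zero_iff] at hu ⊢
        exact (h1 _).trans (by simpa using hu)
    rw [this, Measure.addHaar_image_continuousLinearMap, h4, volume_closedBall_eq _ zero_le_one,
      mul_comm]
    simp
  · have hJ : jacobian L = 0 := by
      by_contra h
      exact hL (surjective_of_jacobian_ne_zero h)
    rw [hJ, ENNReal.ofReal_zero, mul_zero]
    refine measure_mono_null ?_ (Measure.addHaar_submodule volume (LinearMap.range L.toLinearMap)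
      fun h ↦ hL (LinearMap.range_eq_top.1 h))
    rintro _ ⟨y, -, rfl⟩
    exact ⟨y, rfl⟩

/-! ### Density points and approximate derivatives -/

section Density

variable {k : ℕ} {S : Set (EuclideanSpace ℝ (Fin k))} {x : EuclideanSpace ℝ (Fin k)}

lemma ae_isDensityPoint (hS : NullMeasurableSet S volume) :
    ∀ᵐ x : EuclideanSpace ℝ (Fin k), x ∈ S → IsDensityPoint S x := by
  have h := Besicovitch.ae_tendsto_measure_inter_div volume S
  rw [ae_restrict_iff'₀ hS] at h
  filter_upwards [h] with x hx hxS
  refine ⟨hxS, (hx hxS).congr' ?_⟩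
  filter_upwards [self_mem_nhdsWithin] with r (hr : 0 < r)
  have hae : Metric.closedBall x r =ᵐ[volume] Metric.ball x r :=
    (ae_eq_of_subset_of_measure_ge Metric.ball_subset_closedBall
      (by rw [volume_closedBall_eq _ hr.le, volume_ball_eq _ hr])
      Metric.isOpen_ball.measurableSet.nullMeasurableSet
      (measure_closedBall_lt_top.ne)).symm
  rw [measure_congr hae, measure_congr ((ae_eq_refl S).inter hae)]

lemma IsDensityPoint.tendsto_diff (hS : NullMeasurableSet S volume) (hx : IsDensityPoint S x) :
    Tendsto (fun r : ℝ ↦ volume (Metric.ball x r \ S) / volume (Metric.ball x r))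
      (𝓝[>] 0) (𝓝 0) := by
  have h := ENNReal.Tendsto.sub (tendsto_const_nhds (x := (1 : ℝ≥0∞)) (f := 𝓝[>] (0 : ℝ))) hx.2
    (Or.inl ENNReal.one_ne_top)
  rw [tsub_self] at h
  refine h.congr' ?_
  filter_upwards [self_mem_nhdsWithin] with r (hr : 0 < r)
  have h0 : volume (Metric.ball x r) ≠ 0 := (Metric.measure_ball_pos _ _ hr).ne'
  have h1 : volume (Metric.ball x r) ≠ ∞ := measure_ball_lt_top.ne
  have h2 := measure_inter_add_sdiff₀ (Metric.ball x r) hS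
  rw [Set.inter_comm] at h2
  have h3 : volume (S ∩ Metric.ball x r) / volume (Metric.ball x r) ≠ ∞ :=
    ENNReal.div_ne_top (measure_ne_top_of_subset Set.inter_subset_right h1) h0
  refine (ENNReal.eq_sub_of_add_eq h3 ?_).symm
  rw [← ENNReal.add_div, add_comm, h2, ENNReal.div_self h0 h1]

lemma IsDensityPoint.eventually_diff_le (hS : NullMeasurableSet S volume)
    (hx : IsDensityPoint S x) {ε : ℝ≥0∞} (hε : 0 < ε) :
    ∀ᶠ r : ℝ in 𝓝[>] 0, volume (Metric.ball x r \ S) ≤ ε * volume (Metric.ball x r) := by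
  filter_upwards [(hx.tendsto_diff hS).eventually_le_const hε, self_mem_nhdsWithin]
    with r hr (hr0 : 0 < r)
  exact (ENNReal.div_le_iff (Metric.measure_ball_pos _ _ hr0).ne' measure_ball_lt_top.ne).1 hr

/-- Every point near a density point `x` of `S` is close to `S`, relative to its distance to
`x`. -/
lemma IsDensityPoint.eventually_exists_dist_le (hS : NullMeasurableSet S volume)
    (hx : IsDensityPoint S x) {η : ℝ} (hη : 0 < η) :
    ∀ᶠ z in 𝓝 x, ∃ y ∈ S, dist y z ≤ η * dist z x := by
  wlog hη1 : η ≤ 1 generalizing η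
  · filter_upwards [this one_pos le_rfl] with z ⟨y, hy, hyz⟩
    exact ⟨y, hy, hyz.trans (by gcongr; linarith)⟩
  -- A ball of radius `η r` missing `S` would fill the fraction `(η / 2) ^ k` of `B(x, 2r)`, more
  -- than the allowed `(η / 4) ^ k` when `k > 0`.
  have hε : 0 < ENNReal.ofReal (η / 4) ^ k := ENNReal.pow_pos (by simpa using hη) k
  have h := hx.eventually_diff_le hS hε
  rw [eventually_nhdsWithin_iff, Metric.eventually_nhds_iff] at h
  obtain ⟨δ, hδ, h⟩ := h
  filter_upwards [Metric.ball_mem_nhds x (half_pos hδ)] with z hz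
  rcases eq_or_ne z x with rfl | hzx
  · exact ⟨z, hx.1, by simp⟩
  have hr : 0 < dist z x := dist_pos.2 hzx
  rw [Metric.mem_ball] at hz
  set r := dist z x
  by_contra! H
  have h1 := h (y := 2 * r) (by rw [Real.dist_eq, sub_zero, abs_of_pos (by positivity)]; linarith)
    (by simpa using hr)
  have h2 : Metric.ball z (η * r) ⊆ Metric.ball x (2 * r) \ S := by
    intro y hy
    rw [Metric.mem_ball] at hy
    refine ⟨?_, fun hyS ↦ (H y hyS).not_gt hy⟩
    rw [Metric.mem_ball]
    have := dist_triangle y z x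
    nlinarith
  have h3 := (measure_mono h2).trans h1
  rw [volume_ball_eq _ (by positivity), volume_ball_eq _ (by positivity), mul_left_comm, ← mul_pow,
    ENNReal.mul_le_mul_iff_right (unitBallVolume_pos k).ne' (unitBallVolume_ne_top k),
    ← ENNReal.ofReal_mul (by positivity)] at h3
  rcases Nat.eq_zero_or_pos k with rfl | hk
  · exact hzx (Subsingleton.elim _ _)
  · have h4 := (ENNReal.pow_le_pow_left_iff hk.ne').1 h3
    rw [ENNReal.ofReal_le_ofReal_iff (by positivity)] at h4
    nlinarith

variable {n : ℕ} {f : EuclideanSpace ℝ (Fin k) → EuclideanSpace ℝ (Fin n)}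
  {L : EuclideanSpace ℝ (Fin k) →L[ℝ] EuclideanSpace ℝ (Fin n)}
  {A : Set (EuclideanSpace ℝ (Fin k))}

/-- An approximate derivative of a Lipschitz map is a derivative within its domain. -/
lemma HasApproxDerivAt.hasFDerivWithinAt {K : NNReal} (hf : LipschitzOnWith K f A)
    (h : HasApproxDerivAt f A L x) : HasFDerivWithinAt f L A x := by
  obtain ⟨S, hSA, hS, hx, hd⟩ := h
  rw [hasFDerivWithinAt_iff_isLittleO, Asymptotics.isLittleO_iff] at hd ⊢
  intro ε hε
  have hC : 0 < K + ‖L‖ + 2 := by positivity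
  -- Comparing `z ∈ A` with a nearby `y ∈ S` costs `K η` from `f`, `‖L‖ η` from `L` and `2 η` from
  -- the derivative at `y`, since `η ≤ 1` gives `|y - x| ≤ 2 |z - x|`.
  set η := min 1 (ε / (K + ‖L‖ + 2))
  have hη : 0 < η := lt_min one_pos (by positivity)
  have hη1 : η ≤ 1 := min_le_left _ _
  have hη2 : η * (K + ‖L‖ + 2) ≤ ε := by
    rw [← le_div_iff₀ hC]; exact min_le_right _ _
  have h1 := hd hη
  rw [eventually_nhdsWithin_iff, Metric.eventually_nhds_iff] at h1
  obtain ⟨δ, hδ, h1⟩ := h1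
  rw [eventually_nhdsWithin_iff]
  filter_upwards [hx.eventually_exists_dist_le hS hη, Metric.ball_mem_nhds x (half_pos hδ)]
    with z ⟨y, hy, hyz⟩ hz hzA
  rw [Metric.mem_ball] at hz
  have hyx : dist y x ≤ 2 * dist z x := by
    nlinarith [dist_triangle y z x, dist_nonneg (x := z) (y := x)]
  have h2 := h1 (y := y) (by linarith) hy
  have h3 : ‖f z - f y‖ ≤ K * (η * dist z x) := by
    rw [← dist_eq_norm, dist_comm]
    exact (hf.dist_le_mul _ (hSA hy) _ hzA).trans (by gcongr)
  have h4 : ‖L (y - z)‖ ≤ ‖L‖ * (η * dist z x) :=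
    (L.le_opNorm _).trans (by rw [← dist_eq_norm y z]; gcongr)
  rw [← dist_eq_norm y x] at h2
  have h5 : f z - f x - L (z - x) = (f z - f y) + (f y - f x - L (y - x)) + L (y - z) := by
    simp only [map_sub]; abel
  rw [h5, ← dist_eq_norm z x]
  calc _ ≤ ‖f z - f y‖ + ‖f y - f x - L (y - x)‖ + ‖L (y - z)‖ := norm_add₃_le
    _ ≤ K * (η * dist z x) + η * (2 * dist z x) + ‖L‖ * (η * dist z x) := by
        gcongr
        exact h2.trans (by gcongr)
    _ = η * (K + ‖L‖ + 2) * dist z x := by ring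
    _ ≤ ε * dist z x := by gcongr

/-- In every direction `v`, density supplies points of `S` within `ε s ‖v‖` of `x + s v`. There both
`L` and `B` approximate the increment of `f`; then `ε → 0`. -/
lemma IsDensityPoint.norm_sub_le_of_approximatesLinearOn (hS : NullMeasurableSet S volume)
    (hx : IsDensityPoint S x) (hd : HasFDerivWithinAt f L S x)
    {B : EuclideanSpace ℝ (Fin k) →L[ℝ] EuclideanSpace ℝ (Fin n)} {c : NNReal}
    (hB : ApproximatesLinearOn f B S c) : ‖L - B‖ ≤ c := by
  refine ContinuousLinearMap.opNorm_le_bound _ c.2 fun v ↦ ?_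
  rcases eq_or_ne v 0 with rfl | hv
  · simp
  have hv' : 0 < ‖v‖ := norm_pos_iff.2 hv
  have key : ∀ ε : ℝ, 0 < ε →
      ‖(L - B) v‖ ≤ ((c + ε) * (1 + ε) + ‖L - B‖ * ε) * ‖v‖ := by
    intro ε hε
    rw [hasFDerivWithinAt_iff_isLittleO, Asymptotics.isLittleO_iff] at hd
    have h1 := hd hε
    rw [eventually_nhdsWithin_iff, Metric.eventually_nhds_iff] at h1
    obtain ⟨δ, hδ, h1⟩ := h1
    have hcont : Tendsto (fun s : ℝ ↦ x + s • v) (𝓝[>] 0) (𝓝 x) := by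
      have : Continuous fun s : ℝ ↦ x + s • v := by fun_prop
      simpa using (this.tendsto 0).mono_left nhdsWithin_le_nhds
    have hsmall : Tendsto (fun s : ℝ ↦ (1 + ε) * (s * ‖v‖)) (𝓝[>] 0) (𝓝 0) := by
      have : Continuous fun s : ℝ ↦ (1 + ε) * (s * ‖v‖) := by fun_prop
      simpa using (this.tendsto 0).mono_left nhdsWithin_le_nhds
    obtain ⟨s, ⟨y, hy, hyz⟩, hs1, hs⟩ := ((hcont.eventually
      (hx.eventually_exists_dist_le hS hε)).and ((hsmall.eventually_lt_const hδ).and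
        self_mem_nhdsWithin)).exists
    have hs : 0 < s := hs
    have hzx : dist (x + s • v) x = s * ‖v‖ := by
      simp [norm_smul, abs_of_pos hs]
    rw [hzx] at hyz
    have hyx : ‖y - x‖ ≤ (1 + ε) * (s * ‖v‖) := by
      rw [← dist_eq_norm]
      linarith [dist_triangle y (x + s • v) x]
    have h2 := h1 (y := y) (by rw [dist_eq_norm]; linarith) hy
    have h3 := hB y hy x hx.1
    have h4 : ‖(L - B) (x + s • v - y)‖ ≤ ‖L - B‖ * (ε * (s * ‖v‖)) :=
      (ContinuousLinearMap.le_opNorm _ _).trans (by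
        rw [← dist_eq_norm (x + s • v) y, dist_comm]; gcongr)
    have h5 : s • (L - B) v = (f y - f x - B (y - x)) - (f y - f x - L (y - x)) +
        (L - B) (x + s • v - y) := by
      simp only [map_sub, map_add, map_smul, sub_apply, smul_sub]; abel
    have h6 : s * ‖(L - B) v‖ ≤ s * (((c + ε) * (1 + ε) + ‖L - B‖ * ε) * ‖v‖) := by
      calc s * ‖(L - B) v‖ = ‖s • (L - B) v‖ := by rw [norm_smul, Real.norm_of_nonneg hs.le]
        _ ≤ ‖f y - f x - B (y - x)‖ + ‖f y - f x - L (y - x)‖ +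
            ‖(L - B) (x + s • v - y)‖ := by
          rw [h5]
          exact (norm_add_le _ _).trans (by gcongr; exact norm_sub_le _ _)
        _ ≤ c * ((1 + ε) * (s * ‖v‖)) + ε * ((1 + ε) * (s * ‖v‖)) +
            ‖L - B‖ * (ε * (s * ‖v‖)) := by
          gcongr
          · exact h3.trans (by gcongr)
          · exact h2.trans (by gcongr)
        _ = _ := by ring
    exact le_of_mul_le_mul_left h6 hs
  have hlim : Tendsto (fun ε : ℝ ↦ ((c + ε) * (1 + ε) + ‖L - B‖ * ε) * ‖v‖) (𝓝[>] 0)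
      (𝓝 (c * ‖v‖)) := by
    have : Continuous fun ε : ℝ ↦ ((c + ε) * (1 + ε) + ‖L - B‖ * ε) * ‖v‖ := by fun_prop
    simpa using (this.tendsto 0).mono_left nhdsWithin_le_nhds
  exact ge_of_tendsto hlim (by filter_upwards [self_mem_nhdsWithin] with ε hε using key ε hε)

lemma IsDensityPoint.approximatesLinearOn_of_hasFDerivWithinAt (hS : NullMeasurableSet S volume)
    (hx : IsDensityPoint S x) (hd : HasFDerivWithinAt f L S x)
    {B : EuclideanSpace ℝ (Fin k) →L[ℝ] EuclideanSpace ℝ (Fin n)} {c : NNReal}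
    (hB : ApproximatesLinearOn f B S c) : ApproximatesLinearOn f L S (2 * c) := by
  intro y hy z hz
  have h1 := hB y hy z hz
  have h2 : ‖(L - B) (y - z)‖ ≤ c * ‖y - z‖ := (ContinuousLinearMap.le_opNorm _ _).trans
    (by gcongr; exact hx.norm_sub_le_of_approximatesLinearOn hS hd hB)
  have h3 : f y - f z - L (y - z) = (f y - f z - B (y - z)) - (L - B) (y - z) := by
    simp only [sub_apply]; abel
  rw [h3]
  refine (norm_sub_le _ _).trans ?_
  rw [NNReal.coe_mul, NNReal.coe_ofNat]
  linarith

end Density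

/-! ### Upper and lower density bounds -/

instance isAddHaarMeasure_volume_euclideanSpace_prod (n m : ℕ) :
    (volume : Measure (EuclideanSpace ℝ (Fin n) × EuclideanSpace ℝ (Fin m))).IsAddHaarMeasure :=
  Measure.prod.instIsAddHaarMeasure volume volume

section Bounds

variable {n m : ℕ} {A : Set (EuclideanSpace ℝ (Fin (n + m)))}
  {f : EuclideanSpace ℝ (Fin (n + m)) → EuclideanSpace ℝ (Fin n)}
  {L : EuclideanSpace ℝ (Fin (n + m)) →L[ℝ] EuclideanSpace ℝ (Fin n)}
  {x : EuclideanSpace ℝ (Fin (n + m))}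

lemma volume_image_add_smul (a : EuclideanSpace ℝ (Fin n)) {r : ℝ} (hr : 0 ≤ r)
    (T : Set (EuclideanSpace ℝ (Fin n))) :
    volume ((fun u ↦ a + r • u) '' T) = ENNReal.ofReal r ^ n * volume T := by
  have h : (fun u ↦ a + r • u) '' T = (fun y ↦ a + y) '' ((fun u ↦ r • u) '' T) := by
    rw [Set.image_image]
  rw [h, Set.image_add_left, measure_preimage_add, Set.image_smul, Measure.addHaar_smul,
    finrank_euclideanSpace_fin, abs_of_nonneg (by positivity), ENNReal.ofReal_pow hr]

/-- Near `x` the image `f (B(x,r) ∩ A)` lies in a small neighbourhood of the ellipsoid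
`f x + L (B(0,r))`. -/
lemma eventually_contentRatio_le (hd : HasFDerivWithinAt f L A x) {ε : ℝ} (hε : 0 < ε) :
    ∀ᶠ r in 𝓝[>] 0, contentRatio n f A x r ≤
      volume (Metric.cthickening ε (L '' Metric.closedBall 0 1)) / unitBallVolume n := by
  rw [hasFDerivWithinAt_iff_isLittleO, Asymptotics.isLittleO_iff] at hd
  have h1 := hd hε
  rw [eventually_nhdsWithin_iff, Metric.eventually_nhds_iff] at h1
  obtain ⟨δ, hδ, h1⟩ := h1
  filter_upwards [Ioo_mem_nhdsGT hδ] with r ⟨hr0, hrδ⟩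
  have hsub : f '' (Metric.ball x r ∩ A) ⊆ (fun u ↦ f x + r • u) ''
      Metric.cthickening ε (L '' Metric.closedBall 0 1) := by
    rintro _ ⟨z, ⟨hz, hzA⟩, rfl⟩
    rw [Metric.mem_ball] at hz
    refine ⟨r⁻¹ • (f z - f x), ?_, ?_⟩
    · have hz' : ‖z - x‖ ≤ r := by rw [← dist_eq_norm]; exact hz.le
      refine Metric.mem_cthickening_of_dist_le _ (L (r⁻¹ • (z - x))) _ _
        (Set.mem_image_of_mem L ?_) ?_
      · rw [mem_closedBall_zero_iff, norm_smul, Real.norm_of_nonneg (by positivity),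
          inv_mul_le_iff₀ hr0, mul_one]
        exact hz'
      · rw [dist_eq_norm, map_smul, ← smul_sub, norm_smul, Real.norm_of_nonneg (by positivity),
          inv_mul_le_iff₀ hr0, mul_comm]
        exact (h1 (hz.trans hrδ) hzA).trans (by gcongr)
    · simp only
      rw [smul_inv_smul₀ hr0.ne']
      abel
  have hω := (unitBallVolume_pos n).ne'
  have hω' := unitBallVolume_ne_top n
  rw [contentRatio, hausdorffContent_eq_volume]
  refine ENNReal.div_le_of_le_mul ((measure_mono hsub).trans_eq ?_)
  rw [volume_image_add_smul _ hr0.le, ← mul_assoc, ENNReal.div_mul_cancel hω hω', mul_comm]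

/-- The ellipsoid is compact, so the volumes of its `ε`-neighbourhoods decrease to its own. -/
lemma upperDensity_le_jacobian (hd : HasFDerivWithinAt f L A x) :
    upperDensity n f A x ≤ ENNReal.ofReal (jacobian L) := by
  have hC : IsCompact (L '' Metric.closedBall 0 1) :=
    (isCompact_closedBall _ _).image L.continuous
  have hω := (unitBallVolume_pos n).ne'
  have hlim := ENNReal.Tendsto.div_const
    ((tendsto_measure_cthickening_of_isCompact (μ := volume) hC).mono_left
      (nhdsWithin_le_nhds (s := Set.Ioi 0))) (b := unitBallVolume n) (Or.inr hω)
  rw [volume_image_closedBall, mul_comm, ENNReal.mul_div_cancel_right hω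
    (unitBallVolume_ne_top n)] at hlim
  refine ge_of_tendsto hlim ?_
  filter_upwards [self_mem_nhdsWithin] with ε hε
  exact limsup_le_of_le (by isBoundedDefault) (eventually_contentRatio_le hd hε)

/-- At a density point of `t`, most of a small product set inside `B(x, r)` is covered
by `t`. -/
lemma IsDensityPoint.eventually_le_volume_inter
    {t : Set (EuclideanSpace ℝ (Fin (n + m)))} (ht : NullMeasurableSet t volume)
    (hx : IsDensityPoint t x)
    (U : (EuclideanSpace ℝ (Fin n) × EuclideanSpace ℝ (Fin m)) ≃L[ℝ]
      EuclideanSpace ℝ (Fin (n + m)))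
    (hU : ∀ p, ‖U p‖ ≤ ‖p.1‖ + ‖p.2‖) {p₀ : EuclideanSpace ℝ (Fin n) × EuclideanSpace ℝ (Fin m)}
    (hp₀ : U p₀ = x) {δ : ℝ} (hδ : 0 < δ) (hδ1 : δ < 1) :
    ∀ᶠ r : ℝ in 𝓝[>] 0,
      U '' (Metric.ball p₀.1 ((1 - δ) * r) ×ˢ Metric.ball p₀.2 (δ * r)) ⊆ Metric.ball x r ∧
      ENNReal.ofReal (1 - δ) *
        volume (Metric.ball p₀.1 ((1 - δ) * r) ×ˢ Metric.ball p₀.2 (δ * r)) ≤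
      volume ((Metric.ball p₀.1 ((1 - δ) * r) ×ˢ Metric.ball p₀.2 (δ * r)) ∩ U ⁻¹' t) := by
  have : (Measure.map U (volume : Measure (EuclideanSpace ℝ (Fin n) ×
    EuclideanSpace ℝ (Fin m)))).IsAddHaarMeasure := U.isAddHaarMeasure_map _
  -- By uniqueness of Haar measure; the value of `κ` is immaterial because `ε` is chosen after it.
  obtain ⟨κ, hκ⟩ : ∃ κ : NNReal, ∀ s, volume (U ⁻¹' s) = κ * volume s := by
    refine ⟨Measure.addHaarScalarFactor (Measure.map U volume) volume, fun s ↦ ?_⟩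
    have h := Measure.isAddLeftInvariant_eq_smul (Measure.map U (volume : Measure
      (EuclideanSpace ℝ (Fin n) × EuclideanSpace ℝ (Fin m)))) volume
    have h2 := U.toHomeomorph.toMeasurableEquiv.map_apply (μ := volume) s
    have h3 := congrArg (fun μ ↦ μ s) h
    exact h2.symm.trans h3
  -- Both `volume C` and `volume (ball x r)` scale like `r ^ (n + m)`; this `ε` makes the part of
  -- `C` outside `U ⁻¹' t` at most `δ * volume C`. The `+ 1` keeps the denominator nonzero.
  set ε : ℝ≥0∞ := ENNReal.ofReal δ * (unitBallVolume n * ENNReal.ofReal (1 - δ) ^ n *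
    (unitBallVolume m * ENNReal.ofReal δ ^ m)) / ((κ + 1) * unitBallVolume (n + m)) with hεdef
  have hδ' : 0 < 1 - δ := by linarith
  have hδe : 0 < ENNReal.ofReal δ := by simpa using hδ
  have hδe' : 0 < ENNReal.ofReal (1 - δ) := ENNReal.ofReal_pos.2 hδ'
  have hε : 0 < ε := by
    refine ENNReal.div_pos ?_ ?_
    · have := (unitBallVolume_pos n).ne'
      have := (unitBallVolume_pos m).ne'
      have := (ENNReal.pow_pos hδe m).ne'
      have := (ENNReal.pow_pos hδe' n).ne'
      simp_all only [ne_eq, mul_eq_zero, or_self, not_false_eq_true, hδe.ne']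
    · exact ENNReal.mul_ne_top (by simp) (unitBallVolume_ne_top _)
  have hκε : κ * ε * unitBallVolume (n + m) ≤ ENNReal.ofReal δ * (unitBallVolume n *
      ENNReal.ofReal (1 - δ) ^ n * (unitBallVolume m * ENNReal.ofReal δ ^ m)) := by
    calc κ * ε * unitBallVolume (n + m) ≤ (κ + 1) * ε * unitBallVolume (n + m) := by
          gcongr; exact le_self_add
      _ = ε * ((κ + 1) * unitBallVolume (n + m)) := by ring
      _ ≤ _ := ENNReal.mul_le_of_le_div le_rfl
  filter_upwards [hx.eventually_diff_le ht hε, self_mem_nhdsWithin] with r hr (hr0 : 0 < r)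
  set C := Metric.ball p₀.1 ((1 - δ) * r) ×ˢ Metric.ball p₀.2 (δ * r)
  have hCsub : U '' C ⊆ Metric.ball x r := by
    rintro _ ⟨p, ⟨hp1, hp2⟩, rfl⟩
    rw [Metric.mem_ball, dist_eq_norm] at hp1 hp2 ⊢
    rw [← hp₀, ← map_sub]
    refine (hU _).trans_lt ?_
    simp only [Prod.fst_sub, Prod.snd_sub]
    linarith
  refine ⟨hCsub, ?_⟩
  have hCvol : volume C = unitBallVolume n * ENNReal.ofReal (1 - δ) ^ n *
      (unitBallVolume m * ENNReal.ofReal δ ^ m) * ENNReal.ofReal r ^ (n + m) := by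
    rw [Measure.volume_eq_prod, Measure.prod_prod, volume_ball_eq _ (by positivity),
      volume_ball_eq _ (by positivity), ENNReal.ofReal_mul hδ'.le, ENNReal.ofReal_mul hδ.le]
    ring
  have hCtop : volume C ≠ ∞ := by
    rw [Measure.volume_eq_prod, Measure.prod_prod]
    exact ENNReal.mul_ne_top measure_ball_lt_top.ne measure_ball_lt_top.ne
  have hdiff : volume (C \ U ⁻¹' t) ≤ ENNReal.ofReal δ * volume C := by
    calc volume (C \ U ⁻¹' t) ≤ volume (U ⁻¹' (Metric.ball x r \ t)) :=
          measure_mono fun p hp ↦ ⟨hCsub ⟨p, hp.1, rfl⟩, hp.2⟩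
      _ ≤ κ * (ε * volume (Metric.ball x r)) := by rw [hκ]; gcongr
      _ = κ * ε * unitBallVolume (n + m) * ENNReal.ofReal r ^ (n + m) := by
          rw [volume_ball_eq _ hr0]; ring
      _ ≤ _ := by rw [hCvol, ← mul_assoc]; gcongr
  have hfin : ENNReal.ofReal δ * volume C ≠ ∞ := ENNReal.mul_ne_top ENNReal.ofReal_ne_top hCtop
  refine (ENNReal.add_le_add_iff_right hfin).1 ?_
  rw [← add_mul, ← ENNReal.ofReal_add hδ'.le hδ.le, sub_add_cancel, ENNReal.ofReal_one, one_mul]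
  exact (measure_le_inter_add_sdiff _ _ _).trans (by gcongr)

/-- The map `Ψ p = (f (U p), p.2)` is close to `D = M × id`, so it expands volume by at least `q`,
while its image lies in `f(B(x,r) ∩ A)` times a ball, whose volume cancels. The factor `(1 - δ) ^ n`
comes from the shrunken radius, one more `1 - δ` from the density of `t`. -/
lemma eventually_le_contentRatio
    (ht : ∀ c : NNReal, 0 < c → ∃ t ⊆ A, NullMeasurableSet t volume ∧ IsDensityPoint t x ∧
      ApproximatesLinearOn f L t c)
    {q : NNReal} (hq : (q : ℝ≥0∞) < ENNReal.ofReal (jacobian L)) {δ : ℝ} (hδ : 0 < δ)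
    (hδ1 : δ < 1) :
    ∀ᶠ r in 𝓝[>] 0, q * ENNReal.ofReal (1 - δ) ^ (n + 1) ≤ contentRatio n f A x r := by
  have hJ : jacobian L ≠ 0 := by
    intro h
    simp [h] at hq
  obtain ⟨U, M, hU1, -, hLU, hM⟩ := exists_orthogonal_splitting (surjective_of_jacobian_ne_zero hJ)
  let D : (EuclideanSpace ℝ (Fin n) × EuclideanSpace ℝ (Fin m)) →L[ℝ]
      (EuclideanSpace ℝ (Fin n) × EuclideanSpace ℝ (Fin m)) :=
    M.prodMap (ContinuousLinearMap.id ℝ _)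
  have hD : D.det = M.det := by
    have : D.det = LinearMap.det (M.toLinearMap.prodMap
        (LinearMap.id (R := ℝ) (M := EuclideanSpace ℝ (Fin m)))) := rfl
    rw [this, LinearMap.det_prodMap, LinearMap.det_id, mul_one]
  rw [← hM, ← hD] at hq
  obtain ⟨c, hc, hc0⟩ := ((mul_le_addHaar_image_of_lt_det volume D hq).and
    self_mem_nhdsWithin).exists
  have hc0 : 0 < c := hc0
  -- `U` is 2-Lipschitz for the sup norm on the product, so `c / 2` becomes `c` for `Ψ`.
  obtain ⟨t, htA, htm, htx, happ⟩ := ht (c / 2) (by positivity)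
  obtain ⟨p₀, hp₀⟩ := U.surjective x
  filter_upwards [htx.eventually_le_volume_inter htm U hU1 hp₀ hδ hδ1, self_mem_nhdsWithin]
    with r ⟨hCsub, hCt⟩ (hr0 : 0 < r)
  set C := Metric.ball p₀.1 ((1 - δ) * r) ×ˢ Metric.ball p₀.2 (δ * r)
  let Ψ : (EuclideanSpace ℝ (Fin n) × EuclideanSpace ℝ (Fin m)) →
      (EuclideanSpace ℝ (Fin n) × EuclideanSpace ℝ (Fin m)) := fun p ↦ (f (U p), p.2)
  have hΨ : ApproximatesLinearOn Ψ D (C ∩ U ⁻¹' t) c := by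
    intro p hp p' hp'
    have h1 : Ψ p - Ψ p' - D (p - p') = (f (U p) - f (U p') - L (U p - U p'), 0) := by
      rw [← map_sub, hLU]
      ext1 <;> simp [Ψ, D]
    have h2 : ‖U p - U p'‖ ≤ 2 * ‖p - p'‖ := by
      rw [← map_sub]
      refine (hU1 _).trans ?_
      linarith [norm_fst_le (p - p'), norm_snd_le (p - p')]
    rw [h1, Prod.norm_mk, norm_zero, max_eq_left (norm_nonneg _)]
    calc _ ≤ ((c / 2 : NNReal) : ℝ) * ‖U p - U p'‖ := happ _ hp.2 _ hp'.2
      _ ≤ ((c / 2 : NNReal) : ℝ) * (2 * ‖p - p'‖) := by gcongr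
      _ = c * ‖p - p'‖ := by push_cast; ring
  have himage : Ψ '' (C ∩ U ⁻¹' t) ⊆ (f '' (Metric.ball x r ∩ A)) ×ˢ Metric.ball p₀.2 (δ * r) := by
    rintro _ ⟨p, hp, rfl⟩
    exact ⟨⟨U p, ⟨hCsub ⟨p, hp.1, rfl⟩, htA hp.2⟩, rfl⟩, hp.1.2⟩
  have hδ' : 0 < 1 - δ := by linarith
  set W := volume (Metric.ball p₀.2 (δ * r))
  have hW0 : W ≠ 0 := (Metric.measure_ball_pos _ _ (by positivity)).ne'
  have hWt : W ≠ ∞ := measure_ball_lt_top.ne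
  have hCvol : volume C = unitBallVolume n * (ENNReal.ofReal (1 - δ) * ENNReal.ofReal r) ^ n * W := by
    rw [Measure.volume_eq_prod, Measure.prod_prod, volume_ball_eq p₀.1 (by positivity),
      ENNReal.ofReal_mul hδ'.le]
  have hfinal : q * ENNReal.ofReal (1 - δ) ^ (n + 1) * (unitBallVolume n * ENNReal.ofReal r ^ n) * W ≤
      volume (f '' (Metric.ball x r ∩ A)) * W := by
    calc _ = q * (ENNReal.ofReal (1 - δ) * volume C) := by rw [hCvol]; ring
      _ ≤ q * volume (C ∩ U ⁻¹' t) := by gcongr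
      _ ≤ volume (Ψ '' (C ∩ U ⁻¹' t)) := hc _ _ hΨ
      _ ≤ volume ((f '' (Metric.ball x r ∩ A)) ×ˢ Metric.ball p₀.2 (δ * r)) := measure_mono himage
      _ = _ := by rw [Measure.volume_eq_prod, Measure.prod_prod]
  rw [ENNReal.mul_le_mul_iff_left hW0 hWt] at hfinal
  rw [contentRatio, hausdorffContent_eq_volume]
  refine (ENNReal.le_div_iff_mul_le (Or.inl ?_) (Or.inl ?_)).2 hfinal
  · exact mul_ne_zero (unitBallVolume_pos n).ne' (pow_ne_zero _ (by simpa using hr0))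
  · exact ENNReal.mul_ne_top (unitBallVolume_ne_top n) (ENNReal.pow_ne_top ENNReal.ofReal_ne_top)

lemma jacobian_le_lowerDensity
    (ht : ∀ c : NNReal, 0 < c → ∃ t ⊆ A, NullMeasurableSet t volume ∧ IsDensityPoint t x ∧
      ApproximatesLinearOn f L t c) :
    ENNReal.ofReal (jacobian L) ≤ lowerDensity n f A x := by
  refine ENNReal.le_of_forall_nnreal_lt fun q hq ↦ ?_
  have hlim : Tendsto (fun δ : ℝ ↦ (q : ℝ≥0∞) * ENNReal.ofReal (1 - δ) ^ (n + 1)) (𝓝[>] 0)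
      (𝓝 q) := by
    have h1 : Continuous fun δ : ℝ ↦ ENNReal.ofReal (1 - δ) ^ (n + 1) :=
      (ENNReal.continuous_pow _).comp (ENNReal.continuous_ofReal.comp (by fun_prop))
    have h2 := ENNReal.Tendsto.const_mul (a := (q : ℝ≥0∞)) ((h1.tendsto 0).mono_left
      (nhdsWithin_le_nhds (s := Set.Ioi 0))) (Or.inr ENNReal.coe_ne_top)
    simpa using h2
  refine le_of_tendsto hlim ?_
  filter_upwards [Ioo_mem_nhdsGT one_pos] with δ ⟨hδ, hδ1⟩
  exact le_liminf_of_le (by isBoundedDefault) (eventually_le_contentRatio ht hq hδ hδ1)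

end Bounds

/-! ### Almost everywhere approximate linearity and the conclusion -/

/-- At almost every point of its domain, a Lipschitz map is approximately linear, up to
arbitrarily small errors, on sets having this point as a density point. -/
lemma ae_exists_approximatesLinearOn {k n : ℕ} {A : Set (EuclideanSpace ℝ (Fin k))}
    (hA : NullMeasurableSet A volume) {f : EuclideanSpace ℝ (Fin k) → EuclideanSpace ℝ (Fin n)}
    {K : NNReal} (hf : LipschitzOnWith K f A) :
    ∀ᵐ x : EuclideanSpace ℝ (Fin k), x ∈ A → ∀ c : NNReal, 0 < c →
      ∃ t ⊆ A, NullMeasurableSet t volume ∧ IsDensityPoint t x ∧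
        ∃ B : EuclideanSpace ℝ (Fin k) →L[ℝ] EuclideanSpace ℝ (Fin n),
          ApproximatesLinearOn f B t c := by
  have hdiff := hf.ae_differentiableWithinAt_of_mem (μ := volume)
  set s := A ∩ {x | DifferentiableWithinAt ℝ f A x}
  have hsA : s =ᵐ[volume] A := by
    filter_upwards [hdiff] with x hx
    exact propext ⟨fun h ↦ h.1, fun h ↦ ⟨h, hx h⟩⟩
  have hs : NullMeasurableSet s volume := hA.congr hsA.symm
  have hpart := fun j : ℕ ↦ exists_partition_approximatesLinearOn_of_hasFDerivWithinAt f s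
    (fderivWithin ℝ f A) (fun x hx ↦ hx.2.hasFDerivWithinAt.mono Set.inter_subset_left)
    -- One countable partition for each tolerance `1 / (j + 1)`: only countably many null sets of
    -- non-density points are discarded.
    (fun _ ↦ 1 / ((j : NNReal) + 1)) (fun _ ↦ by positivity)
  choose t B _ htm hcov happ _ using hpart
  have hnull : ∀ j i, NullMeasurableSet (s ∩ t j i) volume :=
    fun j i ↦ hs.inter (htm j i).nullMeasurableSet
  have hdens : ∀ᵐ x : EuclideanSpace ℝ (Fin k), ∀ j i, x ∈ s ∩ t j i →
      IsDensityPoint (s ∩ t j i) x :=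
    ae_all_iff.2 fun j ↦ ae_all_iff.2 fun i ↦ ae_isDensityPoint (hnull j i)
  filter_upwards [hdiff, hdens] with x hx hxd hxA c hc
  obtain ⟨j, hj⟩ := exists_nat_one_div_lt hc
  have hxs : x ∈ s := ⟨hxA, hx hxA⟩
  obtain ⟨i, hi⟩ := Set.mem_iUnion.1 (hcov j hxs)
  exact ⟨s ∩ t j i, fun y hy ↦ hy.1.1, hnull j i, hxd j i ⟨hxs, hi⟩, B j i,
    (happ j i).mono_num hj.le⟩

theorem proposition5p1 (n m : ℕ) (A : Set (EuclideanSpace ℝ (Fin (n + m))))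
    (hA : NullMeasurableSet A volume)
    (f : EuclideanSpace ℝ (Fin (n + m)) → EuclideanSpace ℝ (Fin n))
    (hf : ∃ K : NNReal, LipschitzOnWith K f A) :
    ∀ᵐ x : EuclideanSpace ℝ (Fin (n + m)) ∂volume, x ∈ A →
      (∃ L, HasApproxDerivAt f A L x) ∧
      ∀ L, HasApproxDerivAt f A L x →
        lowerDensity n f A x = ENNReal.ofReal (jacobian L) ∧
        upperDensity n f A x = ENNReal.ofReal (jacobian L) := by
  obtain ⟨K, hf⟩ := hf
  filter_upwards [hf.ae_differentiableWithinAt_of_mem (μ := volume), ae_isDensityPoint hA,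
    ae_exists_approximatesLinearOn hA hf] with x hdiff hdens happ hxA
  refine ⟨⟨fderivWithin ℝ f A x, A, subset_rfl, hA, hdens hxA,
    (hdiff hxA).hasFDerivWithinAt⟩, fun L hL ↦ ?_⟩
  have hd := hL.hasFDerivWithinAt hf
  have hupper := upperDensity_le_jacobian hd
  have hlower : ENNReal.ofReal (jacobian L) ≤ lowerDensity n f A x := by
    refine jacobian_le_lowerDensity fun c hc ↦ ?_
    -- Replacing `B` by the given derivative `L` doubles the error.
    obtain ⟨t, htA, htm, htx, B, hB⟩ := happ hxA (c / 2) (by positivity)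
    refine ⟨t, htA, htm, htx, ?_⟩
    have := htx.approximatesLinearOn_of_hasFDerivWithinAt htm (hd.mono htA) hB
    rwa [mul_div_cancel₀ c two_ne_zero] at this
  have hle : lowerDensity n f A x ≤ upperDensity n f A x :=
    liminf_le_limsup (by isBoundedDefault) (by isBoundedDefault)
  exact ⟨(hle.trans hupper).antisymm hlower, hupper.antisymm (hlower.trans hle)⟩
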